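/- Let $S\subset\mathbb{R}$ be a finite set of servers on the line, with capacities $c:S\to\mathbb{N}$. A request sequence is a finite sequence $\sigma=r_1\cdots r_n$ of reals with $n\le\sum_{s\in S}c(s)$. Requests arrive one by one; on arrival each request $r$ must be matched irrevocably, at cost $|r-s|$, with a server $s\in S$ that is free, i.e. has so far been matched with fewer than $c(s)$ requests. For an online algorithm $\mathcal{A}$, let $\mathcal{A}(\sigma|S)$ be its total cost on $\sigma$, and let $\mathrm{Opt}(\sigma|S)$ be the minimum total cost of a matching of all requests of $\sigma$ with servers in which each server $s$ is used at most $c(s)$ times. The algorithm $\mathcal{A}$ is $\rho$-competitive if $\mathcal{A}(\sigma|S)\le\rho\,\mathrm{Opt}(\sigma|S)$ for every request sequence $\sigma$. For $T=\{t_1<\dots<t_m\}$ with $m\ge2$ let $L(T)=\dfrac{t_m-t_1}{\max_u(t_{u+1}-t_u)}$, let $L(T)=0$ if $|T|\le1$, and let $\alpha(S)=\max_{T\subseteq S}L(T)$. The algorithm PTCP, $\mathcal{A}^*[S]$, matches a request $r$, when $F\subseteq S$ is the nonempty set of free servers, with the server $\mathcal{A}^*[S](r,F)$ defined recursively as follows.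 If $F=\{s\}$, then $\mathcal{A}^*[S](r,F)=s$. Otherwise write $S=\{s_1<\dots<s_k\}$ and let $(s_a,s_{a+1})$ be a largest gap, $s_{a+1}-s_a=\max_u(s_{u+1}-s_u)$, where for every set of servers one largest gap is fixed in advance, ties being broken arbitrarily. Put $S_1=\{s_1,\dots,s_a\}$, $S_2=\{s_{a+1},\dots,s_k\}$, $\Delta_1=s_a-s_1$, $\Delta_2=s_k-s_{a+1}$, $D=s_{a+1}-s_a$ and $x=\dfrac{\Delta_2+D}{(\Delta_1+D)+(\Delta_2+D)}\,D$. If ($r\le s_a+x$ and $F\cap S_1\neq\emptyset$) or $F\cap S_2=\emptyset$, then $\mathcal{A}^*[S](r,F)=\mathcal{A}^*[S_1](r,F\cap S_1)$; otherwise $\mathcal{A}^*[S](r,F)=\mathcal{A}^*[S_2](r,F\cap S_2)$. Theorem. For every finite $S\subset\mathbb{R}$, every capacity $c:S\to\mathbb{N}$ and every way of breaking ties between largest gaps, $\mathcal{A}^*[S]$ always chooses a free server, and it is $(2\alpha(S)+1)$-competitive. -/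

import Mathlib

/-- `u < v` are adjacent points of the finite set `T`: no point of `T` lies strictly between. -/
def AdjacentIn (T : Finset ℝ) (u v : ℝ) : Prop :=
  u ∈ T ∧ v ∈ T ∧ u < v ∧ ∀ w ∈ T, w ≤ u ∨ v ≤ w

/-- `(u, v)` is a largest gap of `T`: the points `u < v` are adjacent in `T` and no other pair of
adjacent points of `T` is farther apart. -/
def IsLargestGap (T : Finset ℝ) (u v : ℝ) : Prop :=
  AdjacentIn T u v ∧ ∀ u' v', AdjacentIn T u' v' → v' - u' ≤ v - u

/-- The largest distance between adjacent points of `T` (a maximum over a finite set, nonempty as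
soon as `T` has two points). -/
noncomputable def maxGap (T : Finset ℝ) : ℝ :=
  sSup {d : ℝ | ∃ u v, AdjacentIn T u v ∧ d = v - u}

/-- `(max T - min T) / maxGap T`, and `0` if `T` has at most one point. -/
noncomputable def diamGapRatio (T : Finset ℝ) : ℝ :=
  if h : 1 < T.card then
    (T.max' (Finset.card_pos.mp (by omega)) - T.min' (Finset.card_pos.mp (by omega))) / maxGap T
  else 0

/-- `α(S)`: the maximum of `diamGapRatio T` over all subsets `T` of `S`. -/
noncomputable def alphaRatio (S : Finset ℝ) : ℝ :=
  S.powerset.sup' (Finset.powerset_nonempty S) diamGapRatio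

/-! ### Online facility assignment on a line

A server is identified with its position, so a set of servers is a finite set of reals. A request
sequence is a list of reals. An algorithm is a rule `A : ℝ → Finset ℝ → ℝ` that gives, for a new
request `r` and the set `F` of currently free servers, the server `A r F` that `r` is matched with.
-/

/-- `A` is a legitimate rule for the servers `S`: it always picks a free server. -/
def IsOnlineRule (S : Finset ℝ) (A : ℝ → Finset ℝ → ℝ) : Prop :=
  ∀ (r : ℝ) (F : Finset ℝ), F ⊆ S → F.Nonempty → A r F ∈ F

/-- The free servers when `c s` is the remaining capacity of each server `s`. -/
def freeServers (S : Finset ℝ) (c : ℝ → ℕ) : Finset ℝ :=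
  S.filter fun s => 0 < c s

/-- The list of servers with which `A` matches the successive requests, when it starts with
remaining capacities `c`. -/
noncomputable def assignment (A : ℝ → Finset ℝ → ℝ) (S : Finset ℝ) :
    (ℝ → ℕ) → List ℝ → List ℝ
  | _, [] => []
  | c, r :: σ =>
    let s := A r (freeServers S c)
    s :: assignment A S (Function.update c s (c s - 1)) σ

/-- The cost of matching the `i`-th request of `σ` with the `i`-th server of `τ`, for all `i`. -/
noncomputable def matchingCost (σ τ : List ℝ) : ℝ :=
  (List.zipWith (fun r s => |r - s|) σ τ).sum

/-- `τ` matches every request of `σ` with a server of `S`, within the capacities `c`. -/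
def IsFeasible (S : Finset ℝ) (c : ℝ → ℕ) (σ τ : List ℝ) : Prop :=
  τ.length = σ.length ∧ (∀ s ∈ τ, s ∈ S) ∧ ∀ s ∈ S, τ.count s ≤ c s

/-- The cost `A(σ|S)` incurred by the online rule `A` on `σ`. -/
noncomputable def algCost (A : ℝ → Finset ℝ → ℝ) (S : Finset ℝ) (c : ℝ → ℕ) (σ : List ℝ) : ℝ :=
  matchingCost σ (assignment A S c σ)

/-- The optimal offline cost `Opt(σ|S)`: the minimum cost of a feasible matching. (There are
finitely many feasible `τ`, and at least one if `σ.length ≤ ∑ s ∈ S, c s`.) -/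
noncomputable def optCost (S : Finset ℝ) (c : ℝ → ℕ) (σ : List ℝ) : ℝ :=
  sInf {x : ℝ | ∃ τ, IsFeasible S c σ τ ∧ x = matchingCost σ τ}

/-- `A` is `ρ`-competitive (in the strict sense) for the servers `S` with capacities `c`; request
sequences are those whose length does not exceed the total capacity. -/
def IsCompetitive (S : Finset ℝ) (c : ℝ → ℕ) (A : ℝ → Finset ℝ → ℝ) (ρ : ℝ) : Prop :=
  ∀ σ : List ℝ, σ.length ≤ ∑ s ∈ S, c s → algCost A S c σ ≤ ρ * optCost S c σ

/-! ### The algorithm PTCP -/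

/-- The part of `S` up to `u`. -/
noncomputable def leftPart (S : Finset ℝ) (u : ℝ) : Finset ℝ := S.filter fun s => s ≤ u

/-- The part of `S` from `v` on. -/
noncomputable def rightPart (S : Finset ℝ) (v : ℝ) : Finset ℝ := S.filter fun s => v ≤ s

/-- The critical point `u + x` for the gap `(u, v)` of `S`, where
`x = (Δ₂ + D) / ((Δ₁ + D) + (Δ₂ + D)) * D` with `Δ₁ = u - min S`, `Δ₂ = max S - v`, `D = v - u`. -/
noncomputable def criticalPoint (S : Finset ℝ) (hS : S.Nonempty) (u v : ℝ) : ℝ :=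
  let Δ₁ := u - S.min' hS
  let Δ₂ := S.max' hS - v
  let D := v - u
  u + (Δ₂ + D) / ((Δ₁ + D) + (Δ₂ + D)) * D

/-- A rule `g` selecting one largest gap `((g T).1, (g T).2)` of every set `T` with at least two
points: it fixes how ties between largest gaps are broken. -/
def IsGapRule (g : Finset ℝ → ℝ × ℝ) : Prop :=
  ∀ T : Finset ℝ, 1 < T.card → IsLargestGap T (g T).1 (g T).2

theorem card_leftPart_lt {S : Finset ℝ} {u v : ℝ} (h : IsLargestGap S u v) :
    (leftPart S u).card < S.card :=
  Finset.card_lt_card (Finset.filter_ssubset.mpr ⟨v, h.1.2.1, not_le.mpr h.1.2.2.1⟩)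

theorem card_rightPart_lt {S : Finset ℝ} {u v : ℝ} (h : IsLargestGap S u v) :
    (rightPart S v).card < S.card :=
  Finset.card_lt_card (Finset.filter_ssubset.mpr ⟨u, h.1.1, not_le.mpr h.1.2.2.1⟩)

open Classical in
/-- PTCP for the servers `S`: the server with which a request `r` is matched when `F ⊆ S` is the
nonempty set of free servers. The last value `0` is never reached if `g` is a gap rule and
`F ⊆ S` is nonempty. -/
noncomputable def ptcp (g : Finset ℝ → ℝ × ℝ) (S : Finset ℝ) (r : ℝ) (F : Finset ℝ) : ℝ :=
  if hF : ∃ s, F = {s} then hF.choose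
  else if h : IsLargestGap S (g S).1 (g S).2 then
    if (r ≤ criticalPoint S ⟨_, h.1.1⟩ (g S).1 (g S).2 ∧ F ∩ leftPart S (g S).1 ≠ ∅) ∨
        F ∩ rightPart S (g S).2 = ∅ then
      ptcp g (leftPart S (g S).1) r (F ∩ leftPart S (g S).1)
    else
      ptcp g (rightPart S (g S).2) r (F ∩ rightPart S (g S).2)
  else 0
termination_by S.card
decreasing_by
  · exact card_leftPart_lt h
  · exact card_rightPart_lt h

/-! Extra requests placed exactly at servers use up the remaining capacity: they cost the offline
matching nothing and never lower the online cost, so every server may be assumed to be filled. Call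
the server that the offline matching gives to a request its reserved server.

The bound is proved by induction along the gap tree. At a largest gap `(u, v)`, as many requests are
served to the left as have their reservation there, because both matchings fill every server. Hence
misplaced requests come in pairs, one served left but reserved right, the other the reverse.
Exchanging the two reservations leaves two independent instances, one on each half. PTCP overflows
across the critical point `κ` in only one direction (`IsRun.le_criticalPoint_or`), so in each pair
the same one of the two requests has its reserved server across the gap from its own side of `κ`.
Its charge at rate `ρ` for reaching the far end of the gap pays for both detours of the exchange.

After an exchange the charges are no longer of the form `ρ * |r - o|`, so the induction hypothesis
must be stronger. It allows each request a charge that takes the way to an extreme server at rate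
`ρ` (at rate 1 if the request lies beyond that extreme) and the rest of the way at rate 1. The
exchange inequality `exists_routeCost_swap_le` is closed under these three kinds of charge,
`exists_rearrangement` carries out all exchanges, and `sum_abs_le_sum_routeCost` is the induction.
It starts with every route direct, where the charges add up to `ρ` times the cost of the offline
matching. -/

/-! ### Charges and the exchange inequality. -/

/-- How a request is charged for the server reserved for it: directly, or by a detour through the
leftmost or the rightmost server. -/
inductive Route
  | direct
  | viaMin
  | viaMax

/-- The charge of a request `r` with reserved server `o`, among servers with extremes `m ≤ M`. -/
noncomputable def routeCost (ρ m M r o : ℝ) : Route → ℝ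
  | .direct => ρ * |r - o|
  | .viaMin => max (ρ * (r - m)) (m - r) + (o - m)
  | .viaMax => max (ρ * (M - r)) (r - M) + (M - o)

/-- Reflection of a route at the origin. -/
def Route.reflect : Route → Route
  | .direct => .direct
  | .viaMin => .viaMax
  | .viaMax => .viaMin

theorem routeCost_neg (ρ m M r o : ℝ) (t : Route) :
    routeCost ρ (-M) (-m) (-r) (-o) t.reflect = routeCost ρ m M r o t := by
  cases t
  · simp only [routeCost, Route.reflect]
    rw [← abs_neg]
    congr 2
    ring
  · simp only [routeCost, Route.reflect, neg_sub_neg]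
  · simp only [routeCost, Route.reflect, neg_sub_neg]

/-- The base of the induction: a single server, where both extremes and the reserved server
coincide. -/
theorem abs_le_routeCost_self {ρ r s : ℝ} (hρ : 1 ≤ ρ) (t : Route) :
    |r - s| ≤ routeCost ρ s s r s t := by
  have key : ∀ x : ℝ, x ≤ ρ * |x| := fun x => by
    nlinarith [le_abs_self x, abs_nonneg x]
  cases t <;> simp only [routeCost]
  · nlinarith [abs_nonneg (r - s)]
  · rcases abs_cases (r - s) with ⟨h, h'⟩ | ⟨h, h'⟩ <;> rw [h]
    · have := le_max_left (ρ * (r - s)) (s - r)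
      nlinarith
    · have := le_max_right (ρ * (r - s)) (s - r)
      linarith
  · rcases abs_cases (r - s) with ⟨h, h'⟩ | ⟨h, h'⟩ <;> rw [h]
    · have := le_max_right (ρ * (s - r)) (r - s)
      linarith
    · have := le_max_left (ρ * (s - r)) (r - s)
      nlinarith

/-- The function `x ↦ max (ρ * (x - r)) (r - x)` has slopes at least -1, so adding `x` makes it
monotone. This passes a request that is not misplaced down to its half at no extra charge. -/
theorem routeCost_left_le {ρ m u M r o : ℝ} (hρ : 1 ≤ ρ) (huM : u ≤ M)
    (t : Route) : routeCost ρ m u r o t ≤ routeCost ρ m M r o t := by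
  cases t <;> simp only [routeCost, le_refl]
  have h : max (ρ * (u - r)) (r - u) ≤ max (ρ * (M - r)) (r - M) + (M - u) := by
    have h1 := le_max_left (ρ * (M - r)) (r - M)
    have h2 := le_max_right (ρ * (M - r)) (r - M)
    apply max_le
    · nlinarith
    · linarith
  linarith

theorem routeCost_right_le {ρ m v M r o : ℝ} (hρ : 1 ≤ ρ) (hmv : m ≤ v)
    (t : Route) : routeCost ρ v M r o t ≤ routeCost ρ m M r o t := by
  rw [← routeCost_neg ρ v M, ← routeCost_neg ρ m M]
  exact routeCost_left_le hρ (neg_le_neg hmv) _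

/-- Exchanging the reserved servers of two requests that are served across the gap `(u, v)`, the
first of which lies to the left of `κ`. -/
theorem exists_routeCost_swap_le {ρ m u κ v M r₁ o₁ r₂ o₂ : ℝ} (hρ : 1 ≤ ρ)
    (huκ : u ≤ κ) (hκ : 2 * (v - m) ≤ (ρ + 1) * (v - κ))
    (hr : r₁ ≤ κ) (hκv : κ ≤ v) (ho₁ : v ≤ o₁) (ho₁' : o₁ ≤ M) (ho₂ : m ≤ o₂) (ho₂' : o₂ ≤ u)
    (t₁ t₂ : Route) :
    ∃ t₁' t₂', routeCost ρ m u r₁ o₂ t₁' + routeCost ρ v M r₂ o₁ t₂' ≤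
      routeCost ρ m M r₁ o₁ t₁ + routeCost ρ m M r₂ o₂ t₂ := by
  -- The second branch is `hκ` moved from `κ` to `r₁ ≤ κ`; the first follows from `hκ` and `u ≤ κ`.
  -- The surplus `u - m` covers the way from `u` to `o₂`, and `v - m` covers the detour of the
  -- second request.
  have hX : max (ρ * (u - r₁)) (r₁ - u) ≤ ρ * (v - r₁) - (u - m) - (v - m) := by
    apply max_le <;> nlinarith
  have hY₁ : max (ρ * (r₂ - v)) (v - r₂) ≤ ρ * |r₂ - o₂| + (v - o₂) := by
    have h1 := le_abs_self (r₂ - o₂)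
    have h2 := neg_le_abs (r₂ - o₂)
    have h3 := abs_nonneg (r₂ - o₂)
    apply max_le <;> nlinarith
  have hY₂ : max (ρ * (r₂ - v)) (v - r₂) ≤ max (ρ * (r₂ - m)) (m - r₂) + (v - m) := by
    have h1 := le_max_left (ρ * (r₂ - m)) (m - r₂)
    have h2 := le_max_right (ρ * (r₂ - m)) (m - r₂)
    apply max_le <;> nlinarith
  have hZ₁ : ρ * (v - r₁) + (o₁ - v) ≤ ρ * |r₁ - o₁| := by
    have h := neg_le_abs (r₁ - o₁)
    nlinarith
  have hZ₂ : ρ * (v - r₁) + (M - v) ≤ max (ρ * (M - r₁)) (r₁ - M) := by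
    refine le_trans ?_ (le_max_left _ _)
    nlinarith
  have hm := mul_nonneg (zero_le_one.trans hρ) (abs_nonneg (r₂ - o₂))
  -- A detour through the outer extreme of the new half is kept; every other route is led through
  -- the end of the gap.
  refine ⟨match t₁ with | .viaMin => .viaMin | _ => .viaMax,
    match t₂ with | .viaMax => .viaMax | _ => .viaMin, ?_⟩
  cases t₁ <;> cases t₂ <;> simp only [routeCost] <;> linarith

/-- The mirror image, for overflow in the other direction: reflection at the origin interchanges the
two requests and the two ends of the gap. -/
theorem exists_routeCost_swap_le' {ρ m u κ v M r₁ o₁ r₂ o₂ : ℝ} (hρ : 1 ≤ ρ)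
    (huκ : u ≤ κ) (hκ : 2 * (M - u) ≤ (ρ + 1) * (κ - u))
    (hr : κ ≤ r₂) (hκv : κ ≤ v) (ho₁ : v ≤ o₁) (ho₁' : o₁ ≤ M) (ho₂ : m ≤ o₂) (ho₂' : o₂ ≤ u)
    (t₁ t₂ : Route) :
    ∃ t₁' t₂', routeCost ρ m u r₁ o₂ t₁' + routeCost ρ v M r₂ o₁ t₂' ≤
      routeCost ρ m M r₁ o₁ t₁ + routeCost ρ m M r₂ o₂ t₂ := by
  obtain ⟨t₂', t₁', h⟩ := exists_routeCost_swap_le (ρ := ρ) (m := -M) (u := -v) (κ := -κ)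
    (v := -u) (M := -m) (r₁ := -r₂) (o₁ := -o₂) (r₂ := -r₁) (o₂ := -o₁) hρ (by linarith)
    (by linarith) (by linarith) (by linarith) (by linarith) (by linarith) (by linarith)
    (by linarith) t₂.reflect t₁.reflect
  refine ⟨t₁'.reflect, t₂'.reflect, ?_⟩
  rw [routeCost_neg, routeCost_neg] at h
  rw [← routeCost_neg ρ m u, ← routeCost_neg ρ v M]
  cases t₁' <;> cases t₂' <;> simp only [Route.reflect] at h ⊢ <;> linarith

/-! ### Permuting reservations by exchanges. -/

/-- If as many indices satisfy `p` as have a value satisfying `q`, the values can be permuted so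
that `p` and `q` agree, and the total cost is controlled by the cost of single exchanges. -/
theorem exists_rearrangement {ι κ : Type*} [DecidableEq ι] (p : ι → Prop) (q : ℝ → Prop)
    [DecidablePred p] [DecidablePred q] (o : ι → ℝ) (t : ι → κ) (C C' : ι → ℝ → κ → ℝ)
    (L : Finset ι)
    (hcard : (L.filter p).card = (L.filter fun i => q (o i)).card)
    (hsame : ∀ i ∈ L, (p i ↔ q (o i)) → C' i (o i) (t i) ≤ C i (o i) (t i))
    (hswap : ∀ i ∈ L, ∀ j ∈ L, p i → ¬ q (o i) → ¬ p j → q (o j) →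
      ∃ t₁ t₂, C' i (o j) t₁ + C' j (o i) t₂ ≤ C i (o i) (t i) + C j (o j) (t j)) :
    ∃ (o' : ι → ℝ) (t' : ι → κ), (∀ i ∈ L, (p i ↔ q (o' i))) ∧
      L.val.map o' = L.val.map o ∧
      ∑ i ∈ L, C' i (o' i) (t' i) ≤ ∑ i ∈ L, C i (o i) (t i) := by
  induction L using Finset.strongInduction with
  | H L ih =>
    by_cases hL : ∀ i ∈ L, (p i ↔ q (o i))
    · exact ⟨o, t, hL, rfl, Finset.sum_le_sum fun i hi => hsame i hi (hL i hi)⟩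
    set A := L.filter p with hA
    set B := L.filter fun i => q (o i) with hB
    have hAB : (A \ B).card = (B \ A).card := Finset.card_sdiff_comm hcard
    have hne : (A \ B).Nonempty ∧ (B \ A).Nonempty := by
      rw [← Finset.card_pos, ← Finset.card_pos, ← hAB, and_self, Finset.card_pos,
        Finset.nonempty_iff_ne_empty]
      intro h0
      have h1 : A ⊆ B := Finset.sdiff_eq_empty_iff_subset.mp h0
      have h2 : B ⊆ A := Finset.sdiff_eq_empty_iff_subset.mp
        (Finset.card_eq_zero.mp (by rw [← hAB, h0, Finset.card_empty]))
      apply hL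
      intro i hi
      have := Finset.ext_iff.mp (h1.antisymm h2) i
      simpa [hA, hB, hi] using this
    obtain ⟨⟨i, hi⟩, ⟨j, hj⟩⟩ := hne
    obtain ⟨hiL, hpi, hqi⟩ : i ∈ L ∧ p i ∧ ¬ q (o i) := by
      simp only [hA, hB, Finset.mem_sdiff, Finset.mem_filter] at hi
      tauto
    obtain ⟨hjL, hpj, hqj⟩ : j ∈ L ∧ ¬ p j ∧ q (o j) := by
      simp only [hA, hB, Finset.mem_sdiff, Finset.mem_filter] at hj
      tauto
    have hij : j ≠ i := fun h => hpj (h ▸ hpi)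
    -- Without the misplaced pair the two counts are still equal, so the induction handles the rest
    -- and one exchange settles the pair.
    set L' := (L.erase i).erase j with hL'
    have hjL' : j ∉ L' := Finset.notMem_erase _ _
    have hiL' : i ∉ insert j L' := by simp [hL', hij.symm]
    have hins : insert i (insert j L') = L := by
      rw [hL', Finset.insert_erase (Finset.mem_erase.mpr ⟨hij, hjL⟩), Finset.insert_erase hiL]
    have hsub : L' ⊆ L := (Finset.erase_subset _ _).trans (Finset.erase_subset _ _)
    have hcard' : (L'.filter p).card = (L'.filter fun i => q (o i)).card := by
      have h1 : A = insert i (L'.filter p) := by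
        rw [hA, ← hins, Finset.filter_insert, if_pos hpi, Finset.filter_insert, if_neg hpj]
      have h2 : B = insert j (L'.filter fun i => q (o i)) := by
        rw [hB, ← hins, Finset.filter_insert, if_neg hqi, Finset.filter_insert, if_pos hqj]
      rw [h1, h2, Finset.card_insert_of_notMem (by simp [hL']),
        Finset.card_insert_of_notMem (by simp [hL'])] at hcard
      omega
    obtain ⟨o', t', h1, h2, h3⟩ := ih L' ⟨hsub, fun h => absurd (h hjL) hjL'⟩ hcard'
      (fun k hk => hsame k (hsub hk)) (fun k hk l hl => hswap k (hsub hk) l (hsub hl))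
    obtain ⟨t₁, t₂, ht⟩ := hswap i hiL j hjL hpi hqi hpj hqj
    have hne : ∀ k ∈ L', k ≠ i ∧ k ≠ j := fun k hk =>
      ⟨fun h => hiL' (Finset.mem_insert_of_mem (h ▸ hk)), fun h => hjL' (h ▸ hk)⟩
    refine ⟨fun k => if k = i then o j else if k = j then o i else o' k,
      fun k => if k = i then t₁ else if k = j then t₂ else t' k, ?_, ?_, ?_⟩
    · rw [← hins]
      intro k hk
      rcases Finset.mem_insert.mp hk with rfl | hk
      · simp [hpi, hqj]
      rcases Finset.mem_insert.mp hk with rfl | hk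
      · simp [hij, hpj, hqi]
      · simp [hne k hk, h1 k hk]
    · rw [← hins, Finset.insert_val_of_notMem hiL', Finset.insert_val_of_notMem hjL']
      simp only [Multiset.map_cons, if_true, if_neg hij]
      rw [← h2, Multiset.cons_swap]
      congr 2
      refine Multiset.map_congr rfl fun k hk => ?_
      simp [hne k hk]
    · rw [← hins, Finset.sum_insert hiL', Finset.sum_insert hjL', Finset.sum_insert hiL',
        Finset.sum_insert hjL']
      simp only [if_true, if_neg hij]
      have : ∑ k ∈ L', C' k (if k = i then o j else if k = j then o i else o' k)
          (if k = i then t₁ else if k = j then t₂ else t' k) =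
          ∑ k ∈ L', C' k (o' k) (t' k) :=
        Finset.sum_congr rfl fun k hk => by simp [hne k hk]
      linarith

/-! ### Runs of an online rule, indexed so that repeated requests stay distinct and subsequences can
be taken. -/

/-- `a i` is the server with which the rule `A` matches request `r i`, for the successive indices
`i` of a list, from the capacities `c`. -/
def IsRun (A : ℝ → Finset ℝ → ℝ) (S : Finset ℝ) {ι : Type*} (r a : ι → ℝ) :
    (ℝ → ℕ) → List ι → Prop
  | _, [] => True
  | c, i :: L => a i = A (r i) (freeServers S c) ∧ a i ∈ freeServers S c ∧
      IsRun A S r a (Function.update c (a i) (c (a i) - 1)) L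

theorem mem_freeServers {S : Finset ℝ} {c : ℝ → ℕ} {s : ℝ} :
    s ∈ freeServers S c ↔ s ∈ S ∧ 0 < c s := Finset.mem_filter

theorem freeServers_congr {S : Finset ℝ} {c c' : ℝ → ℕ} (h : ∀ s ∈ S, c s = c' s) :
    freeServers S c = freeServers S c' :=
  Finset.filter_congr fun s hs => by rw [h s hs]

theorem freeServers_filter (S : Finset ℝ) (c : ℝ → ℕ) (p : ℝ → Prop) [DecidablePred p] :
    freeServers (S.filter p) c = freeServers S c ∩ S.filter p := by
  ext s
  simp only [freeServers, Finset.mem_filter, Finset.mem_inter]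
  tauto

variable {ι : Type*} {r a : ι → ℝ}

theorem IsRun.congr {A : ℝ → Finset ℝ → ℝ} {S : Finset ℝ} {L : List ι} {c c' : ℝ → ℕ}
    (h : ∀ s ∈ S, c s = c' s) (hL : IsRun A S r a c L) : IsRun A S r a c' L := by
  induction L generalizing c c' with
  | nil => trivial
  | cons i L ih =>
    obtain ⟨h1, h2, h3⟩ := hL
    rw [freeServers_congr h] at h1 h2
    refine ⟨h1, h2, ih (fun s hs => ?_) h3⟩
    by_cases hsa : s = a i
    · subst hsa
      simp [h _ hs]
    · simp [hsa, h s hs]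

/-- Capacities only decrease, so a server used at any later time is already free at the start; in
particular, a full half stays full. -/
theorem IsRun.mem {A : ℝ → Finset ℝ → ℝ} {S : Finset ℝ} {L : List ι} {c : ℝ → ℕ}
    (hL : IsRun A S r a c L) : ∀ i ∈ L, a i ∈ S ∧ 0 < c (a i) := by
  induction L generalizing c with
  | nil => simp
  | cons i L ih =>
    obtain ⟨-, h2, h3⟩ := hL
    rw [mem_freeServers] at h2
    intro j hj
    rcases List.mem_cons.mp hj with rfl | hj
    · exact h2
    · refine ⟨(ih h3 j hj).1, ?_⟩
      have := (ih h3 j hj).2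
      by_cases hji : a j = a i
      · rw [hji]
        exact h2.2
      · rwa [Function.update_of_ne hji] at this

theorem IsRun.count_le {A : ℝ → Finset ℝ → ℝ} {S : Finset ℝ} {L : List ι} {c : ℝ → ℕ}
    (hL : IsRun A S r a c L) (s : ℝ) : (L.map a).count s ≤ c s := by
  induction L generalizing c with
  | nil => simp
  | cons i L ih =>
    obtain ⟨-, h2, h3⟩ := hL
    rw [mem_freeServers] at h2
    have := ih h3
    rw [List.map_cons, List.count_cons]
    by_cases hs : s = a i
    · subst hs
      simp only [Function.update_self] at this
      simp only [BEq.rfl, if_true]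
      omega
    · rw [Function.update_of_ne hs] at this
      simpa [Ne.symm hs] using this

theorem sum_update_sub_one {S : Finset ℝ} {c : ℝ → ℕ} {s : ℝ} (hs : s ∈ S) (hc : 0 < c s) :
    ∑ x ∈ S, Function.update c s (c s - 1) x + 1 = ∑ x ∈ S, c x := by
  rw [Finset.sum_update_of_mem hs, ← Finset.add_sum_erase S c hs, Finset.sdiff_singleton_eq_erase]
  omega

/-- A list of pairs of requests and servers produced by an online rule is a run. -/
theorem isRun_of_assignment {A : ℝ → Finset ℝ → ℝ} {S : Finset ℝ} (hA : IsOnlineRule S A)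
    {L : List ι} {c : ℝ → ℕ} (hlen : L.length ≤ ∑ s ∈ S, c s)
    (hL : L.map a = assignment A S c (L.map r)) : IsRun A S r a c L := by
  induction L generalizing c with
  | nil => trivial
  | cons i L ih =>
    simp only [List.map_cons, assignment, List.cons.injEq] at hL
    have hmem : a i ∈ freeServers S c := by
      rw [hL.1]
      refine hA _ _ (Finset.filter_subset _ _) ?_
      have : 0 < ∑ s ∈ S, c s := by
        simp only [List.length_cons] at hlen
        omega
      obtain ⟨s, hs, hs0⟩ := Finset.exists_ne_zero_of_sum_ne_zero this.ne'
      exact ⟨s, mem_freeServers.mpr ⟨hs, Nat.pos_of_ne_zero hs0⟩⟩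
    refine ⟨hL.1, hmem, ih ?_ ?_⟩
    · rw [mem_freeServers] at hmem
      have := sum_update_sub_one hmem.1 hmem.2
      simp only [List.length_cons] at hlen
      omega
    · rw [hL.2, ← hL.1]

/-! ### The recursion of PTCP. -/

theorem ptcp_singleton (g : Finset ℝ → ℝ × ℝ) (S : Finset ℝ) (r s : ℝ) :
    ptcp g S r {s} = s := by
  have h : ∃ s', ({s} : Finset ℝ) = {s'} := ⟨s, rfl⟩
  rw [ptcp, dif_pos h]
  exact (Finset.singleton_injective h.choose_spec).symm

theorem inter_leftPart_union {S F : Finset ℝ} {u v : ℝ} (h : IsLargestGap S u v) (hF : F ⊆ S) :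
    F ∩ leftPart S u ∪ F ∩ rightPart S v = F := by
  ext s
  simp only [leftPart, rightPart, Finset.mem_union, Finset.mem_inter, Finset.mem_filter]
  constructor
  · tauto
  · intro hs
    have := h.1.2.2.2 s (hF hs)
    have := hF hs
    tauto

open Classical in
/-- The recursion of `ptcp` holds for every nonempty set of free servers. -/
theorem ptcp_eq {g : Finset ℝ → ℝ × ℝ} {S : Finset ℝ} (h : IsLargestGap S (g S).1 (g S).2)
    {F : Finset ℝ} (hF : F ⊆ S) (r : ℝ) :
    ptcp g S r F =
      if (r ≤ criticalPoint S ⟨_, h.1.1⟩ (g S).1 (g S).2 ∧ F ∩ leftPart S (g S).1 ≠ ∅) ∨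
          F ∩ rightPart S (g S).2 = ∅ then
        ptcp g (leftPart S (g S).1) r (F ∩ leftPart S (g S).1)
      else ptcp g (rightPart S (g S).2) r (F ∩ rightPart S (g S).2) := by
  by_cases hs : ∃ s, F = {s}
  -- The definition stops at a single free server; descending further would reach the same server,
  -- since only one half meets `{s}`.
  · obtain ⟨s, rfl⟩ := hs
    have hu := inter_leftPart_union h hF
    have hlt := h.1.2.2.1
    rw [ptcp_singleton]
    rcases h.1.2.2.2 s (by simpa using hF) with hsu | hsv
    · have h1 : ({s} : Finset ℝ) ∩ leftPart S (g S).1 = {s} := by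
        rw [Finset.inter_eq_left]
        simpa [leftPart, hsu] using hF
      have h2 : ({s} : Finset ℝ) ∩ rightPart S (g S).2 = ∅ := by
        rw [Finset.singleton_inter_of_notMem]
        simp only [rightPart, Finset.mem_filter]
        rintro ⟨-, h⟩
        linarith
      rw [if_pos (Or.inr h2), h1, ptcp_singleton]
    · have h1 : ({s} : Finset ℝ) ∩ rightPart S (g S).2 = {s} := by
        rw [Finset.inter_eq_left]
        simpa [rightPart, hsv] using hF
      have h2 : ({s} : Finset ℝ) ∩ leftPart S (g S).1 = ∅ := by
        rw [Finset.singleton_inter_of_notMem]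
        simp only [leftPart, Finset.mem_filter]
        rintro ⟨-, h⟩
        linarith
      rw [if_neg (by simp [h1, h2]), h1, ptcp_singleton]
  · rw [ptcp, dif_neg hs, dif_pos h]

theorem isOnlineRule_ptcp {g : Finset ℝ → ℝ × ℝ} (hg : IsGapRule g) (S : Finset ℝ) :
    IsOnlineRule S (ptcp g S) := by
  induction S using Finset.strongInduction with
  | H S ih =>
    intro r F hF hne
    by_cases hcard : 1 < S.card
    · have h := hg S hcard
      have hl : leftPart S (g S).1 ⊂ S :=
        Finset.filter_ssubset.mpr ⟨_, h.1.2.1, not_le.mpr h.1.2.2.1⟩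
      have hr : rightPart S (g S).2 ⊂ S :=
        Finset.filter_ssubset.mpr ⟨_, h.1.1, not_le.mpr h.1.2.2.1⟩
      have hu := inter_leftPart_union h hF
      rw [ptcp_eq h hF]
      split_ifs with hc
      · refine (Finset.mem_inter.mp (ih _ hl r _ Finset.inter_subset_right ?_)).1
        rw [Finset.nonempty_iff_ne_empty]
        rcases hc with hc | hc
        · exact hc.2
        · intro h0
          rw [h0, hc, Finset.empty_union] at hu
          exact hne.ne_empty hu.symm
      · refine (Finset.mem_inter.mp (ih _ hr r _ Finset.inter_subset_right ?_)).1
        rw [Finset.nonempty_iff_ne_empty]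
        exact fun h0 => hc (Or.inr h0)
    · obtain ⟨s, hs⟩ := hne
      have h1 : F.card = 1 := by
        have := Finset.card_le_card hF
        have := Finset.card_pos.mpr ⟨s, hs⟩
        omega
      obtain ⟨x, rfl⟩ := Finset.card_eq_one.mp h1
      rw [ptcp_singleton]
      exact Finset.mem_singleton_self x

/-! ### Splitting a run at a largest gap. -/

section Split

variable {g : Finset ℝ → ℝ × ℝ} {S : Finset ℝ} {L : List ι} {c : ℝ → ℕ}

theorem ptcp_of_mem_leftPart (hg : IsGapRule g) (h : IsLargestGap S (g S).1 (g S).2)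
    {F : Finset ℝ} (hF : F ⊆ S) {r : ℝ} (hmem : ptcp g S r F ∈ leftPart S (g S).1) :
    ptcp g S r F = ptcp g (leftPart S (g S).1) r (F ∩ leftPart S (g S).1) ∧
      (criticalPoint S ⟨_, h.1.1⟩ (g S).1 (g S).2 < r → F ∩ rightPart S (g S).2 = ∅) := by
  rw [ptcp_eq h hF] at hmem ⊢
  split_ifs at hmem ⊢ with hc
  · refine ⟨rfl, fun hr => ?_⟩
    rcases hc with hc | hc
    · exact absurd hc.1 (not_le.mpr hr)
    · exact hc
  · exfalso
    have := Finset.mem_inter.mp (isOnlineRule_ptcp hg _ r _ Finset.inter_subset_right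
      (Finset.nonempty_iff_ne_empty.mpr fun h0 => hc (Or.inr h0)))
    have h1 := (Finset.mem_filter.mp this.2).2
    have h2 := (Finset.mem_filter.mp hmem).2
    exact absurd h.1.2.2.1 (by linarith)

theorem ptcp_of_mem_rightPart (hg : IsGapRule g) (h : IsLargestGap S (g S).1 (g S).2)
    {F : Finset ℝ} (hF : F ⊆ S) (hne : F.Nonempty) {r : ℝ}
    (hmem : ptcp g S r F ∈ rightPart S (g S).2) :
    ptcp g S r F = ptcp g (rightPart S (g S).2) r (F ∩ rightPart S (g S).2) ∧
      (r ≤ criticalPoint S ⟨_, h.1.1⟩ (g S).1 (g S).2 → F ∩ leftPart S (g S).1 = ∅) := by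
  have hu := inter_leftPart_union h hF
  rw [ptcp_eq h hF] at hmem ⊢
  split_ifs at hmem ⊢ with hc
  · exfalso
    have := Finset.mem_inter.mp (isOnlineRule_ptcp hg _ r _ Finset.inter_subset_right
      (Finset.nonempty_iff_ne_empty.mpr fun h0 => by
        rcases hc with hc | hc
        · exact hc.2 h0
        · rw [h0, hc, Finset.empty_union] at hu
          exact hne.ne_empty hu.symm))
    have h1 := (Finset.mem_filter.mp this.2).2
    have h2 := (Finset.mem_filter.mp hmem).2
    exact absurd h.1.2.2.1 (by linarith)
  · refine ⟨rfl, fun hr => ?_⟩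
    by_contra h0
    exact hc (Or.inl ⟨hr, h0⟩)

/-- A request served to the right changes no capacity on the left, and one served to the left is
handled by the rule of the left half with the free servers there. So the two halves run
independently. -/
theorem IsRun.filter_leftPart (hg : IsGapRule g) (h : IsLargestGap S (g S).1 (g S).2)
    (hL : IsRun (ptcp g S) S r a c L) :
    IsRun (ptcp g (leftPart S (g S).1)) (leftPart S (g S).1) r a c
      (L.filter fun i => a i ∈ leftPart S (g S).1) := by
  induction L generalizing c with
  | nil => trivial
  | cons i L ih =>
    obtain ⟨h1, h2, h3⟩ := hL
    by_cases hi : a i ∈ leftPart S (g S).1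
    · rw [List.filter_cons_of_pos (by simpa using hi)]
      have hfree : freeServers (leftPart S (g S).1) c = freeServers S c ∩ leftPart S (g S).1 :=
        freeServers_filter _ _ _
      refine ⟨?_, ?_, ih h3⟩
      · rw [hfree, h1]
        exact (ptcp_of_mem_leftPart hg h (Finset.filter_subset _ _) (h1 ▸ hi)).1
      · rw [hfree]
        exact Finset.mem_inter.mpr ⟨h2, hi⟩
    · rw [List.filter_cons_of_neg (by simpa using hi)]
      exact (ih h3).congr fun s hs => Function.update_of_ne (fun e => hi (by rw [← e]; exact hs)) _ _

theorem IsRun.filter_rightPart (hg : IsGapRule g) (h : IsLargestGap S (g S).1 (g S).2)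
    (hL : IsRun (ptcp g S) S r a c L) :
    IsRun (ptcp g (rightPart S (g S).2)) (rightPart S (g S).2) r a c
      (L.filter fun i => a i ∈ rightPart S (g S).2) := by
  induction L generalizing c with
  | nil => trivial
  | cons i L ih =>
    obtain ⟨h1, h2, h3⟩ := hL
    by_cases hi : a i ∈ rightPart S (g S).2
    · rw [List.filter_cons_of_pos (by simpa using hi)]
      have hfree : freeServers (rightPart S (g S).2) c = freeServers S c ∩ rightPart S (g S).2 :=
        freeServers_filter _ _ _
      refine ⟨?_, ?_, ih h3⟩
      · rw [hfree, h1]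
        exact (ptcp_of_mem_rightPart hg h (Finset.filter_subset _ _) ⟨_, h2⟩ (h1 ▸ hi)).1
      · rw [hfree]
        exact Finset.mem_inter.mpr ⟨h2, hi⟩
    · rw [List.filter_cons_of_neg (by simpa using hi)]
      exact (ih h3).congr fun s hs => Function.update_of_ne (fun e => hi (by rw [← e]; exact hs)) _ _

/-- Requests overflow across the critical point in at most one direction. -/
theorem IsRun.le_criticalPoint_or (hg : IsGapRule g) (h : IsLargestGap S (g S).1 (g S).2)
    (hL : IsRun (ptcp g S) S r a c L) :
    (∀ i ∈ L, a i ∈ leftPart S (g S).1 →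
      r i ≤ criticalPoint S ⟨_, h.1.1⟩ (g S).1 (g S).2) ∨
    (∀ i ∈ L, a i ∈ rightPart S (g S).2 →
      criticalPoint S ⟨_, h.1.1⟩ (g S).1 (g S).2 < r i) := by
  induction L generalizing c with
  | nil => simp
  | cons i L ih =>
    have hmem := hL.mem
    obtain ⟨h1, h2, h3⟩ := hL
    have hdisj : ∀ x, x ∈ leftPart S (g S).1 → x ∉ rightPart S (g S).2 := fun x hx hx' => by
      have := h.1.2.2.1
      have := (Finset.mem_filter.mp hx).2
      have := (Finset.mem_filter.mp hx').2
      linarith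
    have hcases : a i ∈ leftPart S (g S).1 ∨ a i ∈ rightPart S (g S).2 := by
      have := (mem_freeServers.mp h2).1
      rcases h.1.2.2.2 _ this with h' | h'
      · exact Or.inl (Finset.mem_filter.mpr ⟨this, h'⟩)
      · exact Or.inr (Finset.mem_filter.mpr ⟨this, h'⟩)
    simp only [List.forall_mem_cons]
    rcases hcases with hi | hi
    · rcases le_or_gt (r i) (criticalPoint S ⟨_, h.1.1⟩ (g S).1 (g S).2) with hr | hr
      · exact (ih h3).imp (fun h' => ⟨fun _ => hr, h'⟩) fun h' =>
          ⟨fun h0 => absurd h0 (hdisj _ hi), h'⟩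
      -- A request beyond the critical point is served on the left only if the right half is full.
      -- Then no later request is served there, and the claim about such requests is vacuous.
      · right
        have hemp : freeServers S c ∩ _ = ∅ := (ptcp_of_mem_leftPart hg h (Finset.filter_subset _ _)
          (h1 ▸ hi)).2 hr
        refine ⟨fun h0 => absurd h0 (hdisj _ hi), fun j hj hja => ?_⟩
        have hj := hmem j (List.mem_cons_of_mem _ hj)
        exact absurd (Finset.mem_inter.mpr ⟨mem_freeServers.mpr hj, hja⟩) (hemp ▸ Finset.notMem_empty _)
    · rcases le_or_gt (r i) (criticalPoint S ⟨_, h.1.1⟩ (g S).1 (g S).2) with hr | hr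
      · left
        have hemp : freeServers S c ∩ _ = ∅ := (ptcp_of_mem_rightPart hg h
          (Finset.filter_subset _ _) ⟨_, h2⟩ (h1 ▸ hi)).2 hr
        refine ⟨fun h0 => absurd hi (hdisj _ h0), fun j hj hja => ?_⟩
        have hj := hmem j (List.mem_cons_of_mem _ hj)
        exact absurd (Finset.mem_inter.mpr ⟨mem_freeServers.mpr hj, hja⟩) (hemp ▸ Finset.notMem_empty _)
      · exact (ih h3).imp (fun h' => ⟨fun h0 => absurd hi (hdisj _ h0), h'⟩) fun h' =>
          ⟨fun _ => hr, h'⟩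

end Split

/-! ### The critical point and the ratio. -/

theorem maxGap_eq {T : Finset ℝ} {u v : ℝ} (h : IsLargestGap T u v) : maxGap T = v - u :=
  IsGreatest.csSup_eq ⟨⟨u, v, h.1, rfl⟩, by rintro _ ⟨u', v', h', rfl⟩; exact h.2 _ _ h'⟩

theorem diamGapRatio_eq {T : Finset ℝ} {u v m M : ℝ} (h : IsLargestGap T u v)
    (hm : IsLeast (T : Set ℝ) m) (hM : IsGreatest (T : Set ℝ) M) :
    diamGapRatio T = (M - m) / (v - u) := by
  have hcard : 1 < T.card := Finset.one_lt_card.mpr ⟨u, h.1.1, v, h.1.2.1, h.1.2.2.1.ne⟩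
  rw [diamGapRatio, dif_pos hcard, maxGap_eq h, (Finset.isLeast_min' T _).unique hm,
    (Finset.isGreatest_max' T _).unique hM]

/-- The critical point divides the gap in the ratio `(M - u) : (v - m)`. This makes the two exchange
inequalities, one for each direction of overflow, hold from the same threshold `ρ = 2 * (M - m) / (v
- u) + 1` on. -/
theorem criticalPoint_bounds {S : Finset ℝ} {u v m M ρ : ℝ} (h : IsLargestGap S u v)
    (hm : IsLeast (S : Set ℝ) m) (hM : IsGreatest (S : Set ℝ) M)
    (hρ : 2 * diamGapRatio S + 1 ≤ ρ) (hS : S.Nonempty) :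
    u ≤ criticalPoint S hS u v ∧ criticalPoint S hS u v ≤ v ∧
      2 * (v - m) ≤ (ρ + 1) * (v - criticalPoint S hS u v) ∧
      2 * (M - u) ≤ (ρ + 1) * (criticalPoint S hS u v - u) := by
  have huv := h.1.2.2.1
  have hmu : m ≤ u := hm.2 h.1.1
  have hvM : v ≤ M := hM.2 h.1.2.1
  rw [diamGapRatio_eq h hm hM] at hρ
  have hD : 0 < v - u := by linarith
  have hW : 0 < v - m + (M - u) := by linarith
  have hρ' : 2 * (v - m + (M - u)) / (v - u) ≤ ρ + 1 := by
    have : 2 * (v - m + (M - u)) / (v - u) = 2 * ((M - m) / (v - u)) + 2 := by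
      field_simp
      ring
    linarith
  have h1 : criticalPoint S hS u v - u = (M - u) / (v - m + (M - u)) * (v - u) := by
    simp only [criticalPoint, (Finset.isLeast_min' S _).unique hm,
      (Finset.isGreatest_max' S _).unique hM]
    rw [show M - v + (v - u) = M - u by ring, show u - m + (v - u) = v - m by ring]
    ring
  have h2 : v - criticalPoint S hS u v = (v - m) / (v - m + (M - u)) * (v - u) := by
    rw [show v - criticalPoint S hS u v = v - u - (criticalPoint S hS u v - u) by ring, h1]
    field_simp
    ring
  have h3 : 0 ≤ (M - u) / (v - m + (M - u)) * (v - u) :=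
    mul_nonneg (div_nonneg (by linarith) hW.le) hD.le
  have h4 : 0 ≤ (v - m) / (v - m + (M - u)) * (v - u) :=
    mul_nonneg (div_nonneg (by linarith) hW.le) hD.le
  refine ⟨by linarith, by linarith, ?_, ?_⟩
  · rw [h2]
    refine le_trans (le_of_eq ?_) (mul_le_mul_of_nonneg_right hρ' h4)
    field_simp
  · rw [h1]
    refine le_trans (le_of_eq ?_) (mul_le_mul_of_nonneg_right hρ' h3)
    field_simp

/-! ### The induction over the halves. -/

theorem card_filter_mem_eq_sum_count {ι : Type*} (L : Finset ι) (f : ι → ℝ) (T : Finset ℝ) :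
    (L.filter fun i => f i ∈ T).card = ∑ s ∈ T, (L.val.map f).count s := by
  have hmaps : Set.MapsTo f (L.filter fun i => f i ∈ T) (T : Set ℝ) := fun i hi =>
    (Finset.mem_filter.mp hi).2
  rw [Finset.card_eq_sum_card_fiberwise hmaps]
  refine Finset.sum_congr rfl fun s hs => ?_
  rw [Multiset.count_map, ← Finset.filter_val, Finset.card_val, Finset.filter_filter]
  congr 1
  refine Finset.filter_congr fun i _ => ?_
  constructor
  · exact fun h => h.2.symm
  · rintro rfl
    exact ⟨hs, rfl⟩

theorem count_map_filter {ι : Type*} (L : Finset ι) (f : ι → ℝ) (p : ι → Prop) [DecidablePred p]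
    (s : ℝ) (h : ∀ i ∈ L, f i = s → p i) :
    ((L.filter p).val.map f).count s = (L.val.map f).count s := by
  rw [Multiset.count_map, Multiset.count_map, ← Finset.filter_val, ← Finset.filter_val,
    Finset.filter_filter, Finset.card_val, Finset.card_val]
  congr 1
  refine Finset.filter_congr fun i hi => ?_
  constructor
  · exact fun h => h.2
  · exact fun h' => ⟨h i hi h'.symm, h'⟩

/-- When the capacities are used up, the cost of PTCP is bounded by the charges of the requests for
any reservation of servers and any choice of routes. -/
theorem sum_abs_le_sum_routeCost {g : Finset ℝ → ℝ × ℝ} (hg : IsGapRule g) {ρ : ℝ} (hρ : 1 ≤ ρ)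
    {ι : Type*} [DecidableEq ι] {r a : ι → ℝ} {c : ℝ → ℕ} (S : Finset ℝ)
    (hS : ∀ T ⊆ S, 2 * diamGapRatio T + 1 ≤ ρ) {m M : ℝ}
    (hm : IsLeast (S : Set ℝ) m) (hM : IsGreatest (S : Set ℝ) M) (L : List ι) (hL : L.Nodup)
    (hrun : IsRun (ptcp g S) S r a c L) (o : ι → ℝ) (t : ι → Route)
    (ho : ∀ i ∈ L.toFinset, o i ∈ S)
    (hcount : ∀ s ∈ S, (L.toFinset.val.map o).count s = c s) :
    ∑ i ∈ L.toFinset, |r i - a i| ≤ ∑ i ∈ L.toFinset, routeCost ρ m M (r i) (o i) (t i) := by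
  induction S using Finset.strongInduction generalizing m M L o t with
  | H S ih =>
    have haS : ∀ i ∈ L.toFinset, a i ∈ S := fun i hi => (hrun.mem i (List.mem_toFinset.mp hi)).1
    by_cases hcard : 1 < S.card
    swap
    · have hall : ∀ x ∈ S, x = m := fun x hx =>
        Finset.card_le_one.mp (not_lt.mp hcard) x hx m hm.1
      obtain rfl : M = m := hall M hM.1
      refine Finset.sum_le_sum fun i hi => ?_
      rw [hall _ (haS i hi), hall _ (ho i hi)]
      exact abs_le_routeCost_self hρ _
    have h := hg S hcard
    set u := (g S).1
    set v := (g S).2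
    have huv : u < v := h.1.2.2.1
    have hmu : m ≤ u := hm.2 h.1.1
    have hvM : v ≤ M := hM.2 h.1.2.1
    have hlS : leftPart S u ⊂ S := Finset.filter_ssubset.mpr ⟨_, h.1.2.1, not_le.mpr huv⟩
    have hrS : rightPart S v ⊂ S := Finset.filter_ssubset.mpr ⟨_, h.1.1, not_le.mpr huv⟩
    have hl : ∀ {x}, x ∈ leftPart S u ↔ x ∈ S ∧ x ≤ u := Finset.mem_filter
    have hr : ∀ {x}, x ∈ rightPart S v ↔ x ∈ S ∧ v ≤ x := Finset.mem_filter
    have hrl : ∀ x ∈ S, (x ∈ rightPart S v ↔ x ∉ leftPart S u) := by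
      intro x hx
      rw [hl, hr]
      rcases h.1.2.2.2 x hx with h' | h'
      · exact ⟨fun h0 => absurd huv (by linarith [h0.2]), fun h0 => absurd ⟨hx, h'⟩ h0⟩
      · exact ⟨fun _ h0 => absurd huv (by linarith [h0.2]), fun _ => ⟨hx, h'⟩⟩
    obtain ⟨huκ, hκv, hκ₁, hκ₂⟩ := criticalPoint_bounds h hm hM (hS S subset_rfl) ⟨_, h.1.1⟩
    have hcard' : (L.toFinset.filter fun i => a i ∈ leftPart S u).card =
        (L.toFinset.filter fun i => o i ∈ leftPart S u).card := by
      -- The run uses each server at most `c s` times, the reservation exactly `c s` times. This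
      -- gives an inequality for each half; as both matchings have the same total, both are
      -- equalities.
      have hle : ∀ T ⊆ S, (L.toFinset.filter fun i => a i ∈ T).card ≤
          (L.toFinset.filter fun i => o i ∈ T).card := by
        intro T hT
        rw [card_filter_mem_eq_sum_count, card_filter_mem_eq_sum_count]
        refine Finset.sum_le_sum fun s hs => ?_
        rw [hcount s (hT hs), List.toFinset_val, hL.dedup, Multiset.map_coe, Multiset.coe_count]
        exact hrun.count_le s
      have h1 := hle _ hlS.subset
      have h2 := hle _ hrS.subset
      have h3 : ∀ f : ι → ℝ, (∀ i ∈ L.toFinset, f i ∈ S) →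
          (L.toFinset.filter fun i => f i ∈ leftPart S u).card +
          (L.toFinset.filter fun i => f i ∈ rightPart S v).card = L.toFinset.card := by
        intro f hf
        rw [Finset.filter_congr fun i hi => hrl _ (hf i hi)]
        exact Finset.card_filter_add_card_filter_not _
      have h4 := h3 a haS
      have h5 := h3 o ho
      omega
    obtain ⟨o', t', h1, h2, h3⟩ := exists_rearrangement (fun i => a i ∈ leftPart S u)
      (fun x => x ∈ leftPart S u) o t (fun i x k => routeCost ρ m M (r i) x k)
      (fun i x k => if a i ∈ leftPart S u then routeCost ρ m u (r i) x k
        else routeCost ρ v M (r i) x k) L.toFinset hcard' (by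
        intro i hi _
        split_ifs
        · exact routeCost_left_le hρ (huv.le.trans hvM) _
        · exact routeCost_right_le hρ (hmu.trans huv.le) _) (by
        intro i hi j hj hpi hqi hpj hqj
        simp only [if_pos hpi, if_neg hpj]
        have hoi := (hr.mp ((hrl _ (ho i hi)).mpr hqi)).2
        have hoj := (hl.mp hqj).2
        rcases hrun.le_criticalPoint_or hg h with h' | h'
        · exact exists_routeCost_swap_le hρ huκ hκ₁ (h' i (List.mem_toFinset.mp hi) hpi) hκv hoi
            (hM.2 (ho i hi)) (hm.2 (ho j hj)) hoj _ _
        · exact exists_routeCost_swap_le' hρ huκ hκ₂ (h' j (List.mem_toFinset.mp hj)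
            ((hrl _ (haS j hj)).mpr hpj)).le hκv hoi (hM.2 (ho i hi)) (hm.2 (ho j hj)) hoj _ _)
    have ho' : ∀ i ∈ L.toFinset, o' i ∈ S := by
      intro i hi
      have : o' i ∈ L.toFinset.val.map o := h2 ▸ Multiset.mem_map_of_mem o' hi
      obtain ⟨j, hj, hji⟩ := Multiset.mem_map.mp this
      exact hji ▸ ho j hj
    refine le_trans ?_ h3
    have hleft := ih _ hlS (fun T hT => hS T (hT.trans hlS.subset)) (m := m) (M := u)
      ⟨hl.mpr ⟨hm.1, hmu⟩, fun x hx => hm.2 (hlS.subset hx)⟩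
      ⟨hl.mpr ⟨h.1.1, le_rfl⟩, fun x hx => (hl.mp hx).2⟩ _ (hL.filter _)
      (hrun.filter_leftPart hg h) o' t'
    have hright := ih _ hrS (fun T hT => hS T (hT.trans hrS.subset)) (m := v) (M := M)
      ⟨hr.mpr ⟨h.1.2.1, le_rfl⟩, fun x hx => (hr.mp hx).2⟩
      ⟨hr.mpr ⟨hM.1, hvM⟩, fun x hx => hM.2 (hrS.subset hx)⟩ _ (hL.filter _)
      (hrun.filter_rightPart hg h) o' t'
    simp only [List.toFinset_filter, decide_eq_true_eq] at hleft hright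
    rw [← Finset.sum_filter_add_sum_filter_not _ (fun i => a i ∈ leftPart S u) fun i => |r i - a i|,
      ← Finset.sum_filter_add_sum_filter_not _ (fun i => a i ∈ leftPart S u)
        fun i => if a i ∈ leftPart S u then _ else _]
    have hfr : (L.toFinset.filter fun i => a i ∉ leftPart S u) =
        L.toFinset.filter fun i => a i ∈ rightPart S v :=
      Finset.filter_congr fun i hi => (hrl _ (haS i hi)).symm
    refine add_le_add ?_ ?_
    · refine (hleft ?_ ?_).trans (le_of_eq (Finset.sum_congr rfl fun i hi => ?_))
      · intro i hi
        rw [Finset.mem_filter] at hi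
        exact (h1 i hi.1).mp hi.2
      · intro s hs
        -- After the rearrangement every request reserved on the left is also served there, so
        -- restricting to the left loses no reservation and the capacities there are still used up.
        rw [count_map_filter _ _ _ _ fun i hi his => (h1 i hi).mpr (by rwa [his]), h2]
        exact hcount s (hlS.subset hs)
      · rw [if_pos (Finset.mem_filter.mp hi).2]
    · rw [hfr]
      refine (hright ?_ ?_).trans (le_of_eq (Finset.sum_congr rfl fun i hi => ?_))
      · intro i hi
        rw [Finset.mem_filter] at hi
        rw [hrl _ (ho' i hi.1), ← h1 i hi.1]
        exact (hrl _ (haS i hi.1)).mp hi.2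
      · intro s hs
        rw [count_map_filter _ _ _ _ fun i hi his => ?_, h2]
        · exact hcount s (hrS.subset hs)
        · rw [hrl _ (haS i hi), h1 i hi, ← hrl _ (ho' i hi)]
          rwa [his]
      · rw [if_neg]
        rw [Finset.mem_filter] at hi
        exact (hrl _ (haS i hi.1)).mp hi.2

/-! ### From runs back to costs, and padding to full capacity. -/

theorem length_assignment (A : ℝ → Finset ℝ → ℝ) (S : Finset ℝ) (c : ℝ → ℕ) (σ : List ℝ) :
    (assignment A S c σ).length = σ.length := by
  induction σ generalizing c with
  | nil => rfl
  | cons r σ ih => simp [assignment, ih]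

theorem matchingCost_nonneg (σ τ : List ℝ) : 0 ≤ matchingCost σ τ := by
  refine List.sum_nonneg fun x hx => ?_
  obtain ⟨i, hi, rfl⟩ := List.mem_iff_getElem.mp hx
  rw [List.getElem_zipWith]
  exact abs_nonneg _

theorem matchingCost_self (σ : List ℝ) : matchingCost σ σ = 0 := by
  simp [matchingCost]

theorem algCost_le_algCost_append (A : ℝ → Finset ℝ → ℝ) (S : Finset ℝ) (c : ℝ → ℕ)
    (σ σ' : List ℝ) : algCost A S c σ ≤ algCost A S c (σ ++ σ') := by
  induction σ generalizing c with
  | nil => exact matchingCost_nonneg _ _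
  | cons r σ ih =>
    have := ih (Function.update c (A r (freeServers S c)) (c (A r (freeServers S c)) - 1))
    simp only [algCost, matchingCost] at this
    simpa [algCost, matchingCost, assignment] using this

/-- Requests are indexed by position; the default value 0 is never read within the range. -/
theorem map_getD_range {l : List ℝ} {n : ℕ} (h : l.length = n) :
    (List.range n).map (fun i => l.getD i 0) = l := by
  subst h
  refine List.ext_getElem (by simp) fun i h1 h2 => ?_
  rw [List.getElem_map, List.getElem_range, List.getD_eq_getElem _ _ h2]

theorem isRun_range {A : ℝ → Finset ℝ → ℝ} {S : Finset ℝ} (hA : IsOnlineRule S A) {c : ℝ → ℕ}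
    {σ : List ℝ} (hlen : σ.length ≤ ∑ s ∈ S, c s) :
    IsRun A S (fun i => σ.getD i 0) (fun i => (assignment A S c σ).getD i 0) c
      (List.range σ.length) := by
  refine isRun_of_assignment hA (by simpa using hlen) ?_
  rw [map_getD_range (length_assignment A S c σ), map_getD_range rfl]

theorem isFeasible_assignment {A : ℝ → Finset ℝ → ℝ} {S : Finset ℝ} (hA : IsOnlineRule S A)
    {c : ℝ → ℕ} {σ : List ℝ} (hlen : σ.length ≤ ∑ s ∈ S, c s) :
    IsFeasible S c σ (assignment A S c σ) := by
  have hrun := isRun_range hA hlen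
  have hmap := map_getD_range (length_assignment A S c σ)
  refine ⟨length_assignment A S c σ, fun s hs => ?_, fun s _ => ?_⟩
  · rw [← hmap] at hs
    obtain ⟨i, hi, rfl⟩ := List.mem_map.mp hs
    exact (hrun.mem i hi).1
  · have := hrun.count_le s
    rwa [hmap] at this

theorem matchingCost_eq_sum {σ τ : List ℝ} {n : ℕ} (hσ : σ.length = n) (hτ : τ.length = n) :
    matchingCost σ τ = ∑ i ∈ (List.range n).toFinset, |σ.getD i 0 - τ.getD i 0| := by
  rw [List.sum_toFinset _ List.nodup_range, matchingCost]
  conv_lhs => rw [← map_getD_range hσ, ← map_getD_range hτ]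
  rw [List.zipWith_map, List.zipWith_self]

/-- A feasible matching extends, by requests located at servers, to one that uses up all
capacities. -/
theorem IsFeasible.exists_append {S : Finset ℝ} {c : ℝ → ℕ} {σ τ : List ℝ}
    (h : IsFeasible S c σ τ) :
    ∃ l : List ℝ, (∀ s ∈ l, s ∈ S) ∧ ∀ s ∈ S, (τ ++ l).count s = c s := by
  have hcount : ∀ x, (∑ s ∈ S, Multiset.replicate (c s - τ.count s) s).toList.count x =
      if x ∈ S then c x - τ.count x else 0 := by
    intro x
    rw [← Multiset.coe_count, Multiset.coe_toList, Multiset.count_sum']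
    simp [Multiset.count_replicate]
  refine ⟨(∑ s ∈ S, Multiset.replicate (c s - τ.count s) s).toList, fun s hs => ?_,
    fun s hs => ?_⟩
  · by_contra h0
    have := List.count_pos_iff.mpr hs
    rw [hcount, if_neg h0] at this
    exact this.ne rfl
  · rw [List.count_append, hcount, if_pos hs]
    have := h.2.2 s hs
    omega

theorem algCost_ptcp_le {g : Finset ℝ → ℝ × ℝ} (hg : IsGapRule g) {ρ : ℝ} (hρ : 1 ≤ ρ)
    {S : Finset ℝ} (hS : ∀ T ⊆ S, 2 * diamGapRatio T + 1 ≤ ρ) (hne : S.Nonempty) {c : ℝ → ℕ}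
    {σ τ : List ℝ} (h : IsFeasible S c σ τ) :
    algCost (ptcp g S) S c σ ≤ ρ * matchingCost σ τ := by
  obtain ⟨l, hlS, hl⟩ := h.exists_append
  have hmem : ∀ s ∈ τ ++ l, s ∈ S := fun s hs =>
    (List.mem_append.mp hs).elim (h.2.1 s) (hlS s)
  have hlen : (τ ++ l).length = (σ ++ l).length := by simp [h.1]
  have hsum : (σ ++ l).length = ∑ s ∈ S, c s := by
    rw [← hlen, ← Finset.sum_congr rfl hl, ← Multiset.coe_card,
      ← Multiset.sum_count_eq_card (s := S) (by simpa using hmem)]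
    simp only [Multiset.coe_count]
  have hA := isOnlineRule_ptcp hg S
  have hmap := map_getD_range hlen
  have key := sum_abs_le_sum_routeCost hg hρ S hS (Finset.isLeast_min' S hne)
    (Finset.isGreatest_max' S hne) _ List.nodup_range (isRun_range hA hsum.le)
    (fun i => (τ ++ l).getD i 0) (fun _ => Route.direct) (fun i hi => hmem _ (by
      have hi : i < (τ ++ l).length := by simpa [h.1] using hi
      rw [List.getD_eq_getElem _ _ hi]
      exact List.getElem_mem hi)) (fun s hs => by
      rw [List.toFinset_val, List.nodup_range.dedup, Multiset.map_coe, hmap, Multiset.coe_count,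
        hl s hs])
  simp only [routeCost, ← Finset.mul_sum] at key
  rw [← matchingCost_eq_sum rfl (length_assignment _ _ _ _), ← matchingCost_eq_sum rfl hlen] at key
  -- Each padding request is reserved for the server at its own position and costs nothing.
  have happ : matchingCost (σ ++ l) (τ ++ l) = matchingCost σ τ := by
    have := matchingCost_self l
    rw [matchingCost] at this
    rw [matchingCost, List.zipWith_append h.1.symm, List.sum_append, this, add_zero, matchingCost]
  rw [happ] at key
  exact (algCost_le_algCost_append _ S c σ l).trans key

theorem theorem1 (g : Finset ℝ → ℝ × ℝ) (hg : IsGapRule g) (S : Finset ℝ) (c : ℝ → ℕ) :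
    IsOnlineRule S (ptcp g S) ∧ IsCompetitive S c (ptcp g S) (2 * alphaRatio S + 1) := by
  have hA := isOnlineRule_ptcp hg S
  refine ⟨hA, fun σ hσ => ?_⟩
  have hα : ∀ T ⊆ S, diamGapRatio T ≤ alphaRatio S := fun T hT =>
    Finset.le_sup' diamGapRatio (Finset.mem_powerset.mpr hT)
  have hα₀ : 0 ≤ alphaRatio S := by
    simpa [diamGapRatio] using hα ∅ (Finset.empty_subset S)
  have hρ : 0 < 2 * alphaRatio S + 1 := by linarith
  rw [← div_le_iff₀' hρ]
  -- The online matching itself is feasible, so the infimum is over a nonempty set and it suffices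
  -- to compare with each feasible matching.
  refine le_csInf ⟨_, _, isFeasible_assignment hA hσ, rfl⟩ ?_
  rintro _ ⟨τ, hτ, rfl⟩
  rw [div_le_iff₀' hρ]
  rcases S.eq_empty_or_nonempty with rfl | hne
  · obtain rfl : σ = [] := by simpa using hσ
    simp [algCost, matchingCost]
  · exact algCost_ptcp_le hg (by linarith) (fun T hT => by linarith [hα T hT]) hne hτ
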